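/- Let $(E,[\![\cdot,\cdot]\!],\rho)$ be a Lie algebroid of finite rank over a (Hausdorff, finite-dimensional) smooth manifold $Q$, with dual bundle $E^*$, and let $\pi: E^*\times\mathbb R\to Q$ be the projection. Let $\mathcal T^E(E^*\times\mathbb R)$ be the prolongation of $E$ over $\pi$: the Lie algebroid over $E^*\times\mathbb R$ whose fibre at $p$ is $\{(a,v)\in E_{\pi(p)}\times T_p(E^*\times\mathbb R) : \rho(a)=T\pi(v)\}$, whose anchor is $\rho^{\pi}(a,v)=v$, and whose bracket is determined by the Leibniz rule and $[\![(\sigma_1\circ\pi,X_1),(\sigma_2\circ\pi,X_2)]\!]^{\pi}=([\![\sigma_1,\sigma_2]\!]\circ\pi,[X_1,X_2])$ for $\sigma_i\in\mathrm{Sec}(E)$ and vector fields $X_i$ on $E^*\times\mathbb R$ that are $\pi$-related to $\rho(\sigma_i)$. Let $d$ be its exterior differential, and let $\eta$ be its contact $1$-section $\eta_{(b,s)}(a,v)=ds(v)-b(a)$, with Reeb section $\mathcal R$ (the section with $i_{\mathcal R}d\eta=0$, $i_{\mathcal R}\eta=1$). For a smooth function $H:E^*\times\mathbb R\to\mathbb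 R$ let $\xi_H$ be the Hamiltonian section, i.e. the section of $\mathcal T^E(E^*\times\mathbb R)$ determined by $$i_{\xi_H}\eta=-H,\qquad i_{\xi_H}d\eta=dH-\rho^{\pi}(\mathcal R)(H)\,\eta .$$ Let $\gamma=(\gamma_0,\gamma_s):Q\to E^*\times\mathbb R$ be a smooth section of $\pi$ and let $F_\gamma=\{(a,T\gamma(\rho(a))) : a\in E\}$, which is a Lie subalgebroid of $\mathcal T^E(E^*\times\mathbb R)$ over the submanifold $\gamma(Q)$. Suppose that $F_\gamma$ is Legendrian, i.e. $\operatorname{rank}\mathcal T^E(E^*\times\mathbb R)=2\operatorname{rank}F_\gamma+1$ and $\eta$ vanishes on $F_\gamma$. Then $\gamma$ is locally the $1$-jet $j^1f=(d^Ef,f)$ of a function $f$ on $Q$, where $d^Ef(a)=\rho(a)f$. Moreover, let $\xi_H^\gamma=\mathrm{pr}_1\circ\xi_H\circ\gamma\in\mathrm{Sec}(E)$. Then $\xi_H$ and $\xi_H^\gamma$ are $\gamma$-related, that is, $$\xi_H(\gamma(q))=\bigl(\xi_H^\gamma(q),\,T_q\gamma(\rho(\xi_H^\gamma(q)))\bigr)\quad\text{for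 all }q\in Q,$$ if and only if the Hamilton--Jacobi equation $H\circ\gamma=0$ holds on $Q$. -/

import Mathlib

open Bundle Set Filter Topology
open scoped Manifold ContDiff Bundle

noncomputable section

namespace ContactAlgebroid

/-- Derivative of a vector-valued function `f` on a manifold at `x` along the tangent vector `v`. -/
def dirDeriv {EM HM M W : Type*} [NormedAddCommGroup EM] [NormedSpace ℝ EM]
    [TopologicalSpace HM] (I : ModelWithCorners ℝ EM HM) [TopologicalSpace M] [ChartedSpace HM M]
    [NormedAddCommGroup W] [NormedSpace ℝ W] (f : M → W) (x : M) (v : TangentSpace I x) : W :=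
  mfderiv I 𝓘(ℝ, W) f x v

section Algebroid

variable {B : Type*} [NormedAddCommGroup B] [NormedSpace ℝ B]
  {Q : Type*} [TopologicalSpace Q] [ChartedSpace B Q]
  {F : Type*} [NormedAddCommGroup F] [NormedSpace ℝ F]
  {E : Q → Type*} [∀ q, AddCommGroup (E q)] [∀ q, Module ℝ (E q)] [∀ q, TopologicalSpace (E q)]
  [TopologicalSpace (TotalSpace F E)] [FiberBundle F E] [VectorBundle ℝ F E]

/-- The section `f • σ` of `E`, for a smooth function `f` and a smooth section `σ`. -/
def smulSection (f : C^∞⟮𝓘(ℝ, B), Q; 𝓘(ℝ, ℝ), ℝ⟯) (σ : Cₛ^∞⟮𝓘(ℝ, B); F, E⟯) :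
    Cₛ^∞⟮𝓘(ℝ, B); F, E⟯ :=
  ⟨fun q ↦ f q • σ q, f.contMDiff.smul_section σ.contMDiff⟩

variable (B F E) in
/-- A Lie algebroid structure on the smooth vector bundle `E → Q` (with typical fibre `F`, over the
manifold `Q` modelled on `B`): a smooth vector bundle map `ρ : E → TQ` over the identity (the
anchor), and a real Lie bracket on the smooth sections of `E`, subject to the Leibniz rule
`⟦σ, f τ⟧ = f ⟦σ, τ⟧ + (ρ(σ) f) τ`. -/
structure LieAlgebroid [IsManifold 𝓘(ℝ, B) ∞ Q] where
  anchor : ∀ q : Q, E q →ₗ[ℝ] TangentSpace 𝓘(ℝ, B) q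
  contMDiff_anchor : ContMDiff (𝓘(ℝ, B).prod 𝓘(ℝ, F)) 𝓘(ℝ, B).tangent ∞
    (fun a : TotalSpace F E ↦ (⟨a.proj, anchor a.proj a.snd⟩ : TangentBundle 𝓘(ℝ, B) Q))
  bracket : Cₛ^∞⟮𝓘(ℝ, B); F, E⟯ → Cₛ^∞⟮𝓘(ℝ, B); F, E⟯ → Cₛ^∞⟮𝓘(ℝ, B); F, E⟯
  bracket_add_right : ∀ σ τ₁ τ₂, bracket σ (τ₁ + τ₂) = bracket σ τ₁ + bracket σ τ₂
  bracket_smul_right : ∀ (c : ℝ) (σ τ), bracket σ (c • τ) = c • bracket σ τ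
  bracket_skew : ∀ σ τ, bracket σ τ = -bracket τ σ
  jacobi : ∀ σ₁ σ₂ σ₃, bracket σ₁ (bracket σ₂ σ₃) + bracket σ₂ (bracket σ₃ σ₁)
    + bracket σ₃ (bracket σ₁ σ₂) = 0
  leibniz : ∀ (f : C^∞⟮𝓘(ℝ, B), Q; 𝓘(ℝ, ℝ), ℝ⟯) (σ τ) (q : Q),
    bracket σ (smulSection f τ) q =
      f q • bracket σ τ q + dirDeriv 𝓘(ℝ, B) f q (anchor q (σ q)) • τ q

/-- Every vector `a ∈ E_q` extends to a smooth global section of `E` which, near `q`, is constant in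
the preferred trivialization of `E` at `q`. -/
theorem exists_constSection [FiniteDimensional ℝ B] [T2Space Q] [IsManifold 𝓘(ℝ, B) ∞ Q]
    [ContMDiffVectorBundle ∞ F E 𝓘(ℝ, B)] (q : Q) (a : E q) :
    ∃ s : Cₛ^∞⟮𝓘(ℝ, B); F, E⟯, ∀ᶠ x in 𝓝 q,
      s x = (trivializationAt F E q).symm x ((trivializationAt F E q) ⟨q, a⟩).2 := by
  set e := trivializationAt F E q with he
  have hq : e.baseSet ∈ 𝓝 q :=
    e.open_baseSet.mem_nhds (FiberBundle.mem_baseSet_trivializationAt' q)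
  obtain ⟨χ, -, hχ⟩ :=
    (SmoothBumpFunction.nhds_basis_tsupport (I := 𝓘(ℝ, B)) q).mem_iff.1 hq
  have hs : ContMDiffOn 𝓘(ℝ, B) (𝓘(ℝ, B).prod 𝓘(ℝ, F)) ∞
      (fun x ↦ (⟨x, e.symm x (e ⟨q, a⟩).2⟩ : TotalSpace F E)) e.baseSet := by
    rw [e.contMDiffOn_section_baseSet_iff]
    refine (contMDiffOn_const (c := (e ⟨q, a⟩).2)).congr fun y hy ↦ ?_
    simp [e.apply_mk_symm hy]
  refine ⟨⟨fun x ↦ χ x • e.symm x (e ⟨q, a⟩).2,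
    ContMDiffOn.smul_section_of_tsupport (s := fun x ↦ e.symm x (e ⟨q, a⟩).2)
      χ.contMDiff.contMDiffOn e.open_baseSet hχ hs⟩, ?_⟩
  filter_upwards [χ.eventuallyEq_one] with x hx
  change χ x • (e.symm x (e ⟨q, a⟩).2 : E x) = _
  rw [hx]; simp

/-- A chosen smooth extension of `a ∈ E_q` to a global section of `E` that is constant near `q` in
the preferred trivialization of `E` at `q`, as in `exists_constSection`. If `(e_α)` is the frame of
that trivialization and `a = a^α e_α(q)`, it coincides with `a^α e_α` near `q`. -/
def constSection [FiniteDimensional ℝ B] [T2Space Q] [IsManifold 𝓘(ℝ, B) ∞ Q]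
    [ContMDiffVectorBundle ∞ F E 𝓘(ℝ, B)] (q : Q) (a : E q) : Cₛ^∞⟮𝓘(ℝ, B); F, E⟯ :=
  (exists_constSection q a).choose

section Prolongation

variable {EP : Type*} [NormedAddCommGroup EP] [NormedSpace ℝ EP] {HP : Type*} [TopologicalSpace HP]
  (IP : ModelWithCorners ℝ EP HP) {P : Type*} [TopologicalSpace P] [ChartedSpace HP P]
  [IsManifold 𝓘(ℝ, B) ∞ Q] (A : LieAlgebroid B F E) (prj : P → Q)

/-- The fibre at `p` of the prolongation `𝒯^E P` of `E` over `prj : P → Q`: the pairs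
`(a, v) ∈ E_{prj(p)} × T_p P` with `ρ(a) = Tprj(v)`. -/
def prolFiber (p : P) : Submodule ℝ (E (prj p) × TangentSpace IP p) where
  carrier := {z | A.anchor (prj p) z.1 = mfderiv IP 𝓘(ℝ, B) prj p z.2}
  add_mem' {z w} hz hw := by
    simp only [Set.mem_ofPred_eq] at hz hw
    simp [hz, hw]
  zero_mem' := by simp
  smul_mem' c z hz := by
    simp only [Set.mem_ofPred_eq] at hz
    simp [hz]

/-- A smooth section `Z = (σ, X)` of `𝒯^E P → P`. As `𝒯^E P` is a submanifold of `E × TP`,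
smoothness is smoothness of the two components `P → E` and `P → TP`. -/
structure ProlSection [IsManifold IP ∞ P] where
  toFun : ∀ p : P, prolFiber IP A prj p
  contMDiff_fst : ContMDiff IP (𝓘(ℝ, B).prod 𝓘(ℝ, F)) ∞
    (fun p ↦ (⟨prj p, (toFun p).1.1⟩ : TotalSpace F E))
  contMDiff_snd : ContMDiff IP IP.tangent ∞
    (fun p ↦ (⟨p, (toFun p).1.2⟩ : TangentBundle IP P))

variable {IP A prj} [IsManifold IP ∞ P]

/-- The `E`-component `pr₁ ∘ Z` of a section of the prolongation. -/
def ProlSection.fst (Z : ProlSection IP A prj) (p : P) : E (prj p) := (Z.toFun p).1.1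

/-- The vector field `ρ^π(Z)` on `P` (the anchor of the prolongation is the second projection). -/
def ProlSection.vec (Z : ProlSection IP A prj) (p : P) : TangentSpace IP p := (Z.toFun p).1.2

/-- The derivative at `p`, along `v ∈ T_p P`, of the `E`-component of `Z`, computed with the
coefficients of `Z` in the frame of the preferred trivialization of `E` at `prj(p)`: writing
`pr₁ ∘ Z = Z^α (e_α ∘ prj)` near `p`, this is `v(Z^α) e_α(prj(p))`. -/
def ProlSection.derivFst (Z : ProlSection IP A prj) (p : P) (v : TangentSpace IP p) : E (prj p) :=
  (trivializationAt F E (prj p)).symm (prj p)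
    (dirDeriv IP (fun p' ↦ (trivializationAt F E (prj p) ⟨prj p', Z.fst p'⟩).2) p v)

/-- The Lie bracket of two sections `Z₁, Z₂` of the prolongation. Its `TP`-component is the bracket
of the vector fields `ρ^π(Z₁), ρ^π(Z₂)`. Its `E`-component at `p` is
`Z₁^α Z₂^β ⟦e_α, e_β⟧ + ρ^π(Z₁)(Z₂^α) e_α - ρ^π(Z₂)(Z₁^α) e_α`, where `(e_α)` is a local frame of `E`
near `prj(p)` and `pr₁ ∘ Zᵢ = Zᵢ^α (e_α ∘ prj)`; this is the Leibniz extension of the relations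
`⟦𝒳_α, 𝒳_β⟧ = 𝒞^γ_{αβ} 𝒳_γ`, `⟦𝒳_α, 𝒱_ℓ⟧ = 0`, `⟦𝒱_ℓ, 𝒱_φ⟧ = 0`.
It is recorded as an element of `E_{prj(p)} × T_p P`, which contains the fibre of `𝒯^E P`. -/
def prolBracket [FiniteDimensional ℝ B] [T2Space Q] [ContMDiffVectorBundle ∞ F E 𝓘(ℝ, B)]
    (Z₁ Z₂ : ProlSection IP A prj) (p : P) : E (prj p) × TangentSpace IP p :=
  (A.bracket (constSection (prj p) (Z₁.fst p)) (constSection (prj p) (Z₂.fst p)) (prj p)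
      + Z₂.derivFst p (Z₁.vec p) - Z₁.derivFst p (Z₂.vec p),
    VectorField.mlieBracket IP Z₁.vec Z₂.vec p)

/-- The exterior differential of a `1`-section `μ` of the prolongation, evaluated on two sections:
`dμ(Z₁, Z₂) = ρ^π(Z₁)(μ(Z₂)) - ρ^π(Z₂)(μ(Z₁)) - μ(⟦Z₁, Z₂⟧)`. -/
def extDerivOne [FiniteDimensional ℝ B] [T2Space Q] [ContMDiffVectorBundle ∞ F E 𝓘(ℝ, B)]
    (μ : ∀ p : P, (E (prj p) × TangentSpace IP p) →ₗ[ℝ] ℝ) (Z₁ Z₂ : ProlSection IP A prj) (p : P) : ℝ :=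
  dirDeriv IP (fun p' ↦ μ p' (Z₂.toFun p')) p (Z₁.vec p)
    - dirDeriv IP (fun p' ↦ μ p' (Z₁.toFun p')) p (Z₂.vec p)
    - μ p (prolBracket Z₁ Z₂ p)

variable (A) in
/-- Let `η` be a `1`-section of `𝒯^E P`, regarded as a contact algebroid of rank `2k + 1`. A
subalgebroid `S` of `𝒯^E P` along `i : N → P` is Legendrian if `S` has rank `k` and `η` vanishes on
`S`. (Closure under the algebroid structure does not enter: the predicate is used below for a
subbundle which is the image of an algebroid morphism.) -/
def IsLegendrian (η : ∀ p : P, (E (prj p) × TangentSpace IP p) →ₗ[ℝ] ℝ) {N : Type*} (i : N → P)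
    (S : ∀ x : N, Submodule ℝ (prolFiber IP A prj (i x))) : Prop :=
  ∀ x : N, 2 * Module.finrank ℝ (S x) + 1 = Module.finrank ℝ (prolFiber IP A prj (i x)) ∧
    ∀ z ∈ S x, η (i x) z = 0

end Prolongation

section Hamiltonian

variable (B F E) in
/-- The manifold `E^* × ℝ`. -/
abbrev DualLine : Type _ := TotalSpace (F →L[ℝ] ℝ) (fun q ↦ E q →L[ℝ] ℝ) × ℝ

variable (B F) in
/-- The model with corners of `E^* × ℝ`. -/
abbrev dualLineModel : ModelWithCorners ℝ ((B × (F →L[ℝ] ℝ)) × ℝ)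
    (ModelProd (ModelProd B (F →L[ℝ] ℝ)) ℝ) :=
  (𝓘(ℝ, B).prod 𝓘(ℝ, F →L[ℝ] ℝ)).prod 𝓘(ℝ, ℝ)

/-- The projection `E^* × ℝ → Q`. -/
abbrev dualLineProj (p : DualLine F E) : Q := p.1.proj

variable [∀ q, IsTopologicalAddGroup (E q)] [∀ q, ContinuousSMul ℝ (E q)]
  [IsManifold 𝓘(ℝ, B) ∞ Q] [ContMDiffVectorBundle ∞ F E 𝓘(ℝ, B)]
  (A : LieAlgebroid B F E)

/-- The fibre at `p` of the contact Hamiltonian prolongation `𝒯^E(E^* × ℝ)`. -/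
abbrev HamFiber (p : DualLine F E) : Type _ := prolFiber (dualLineModel B F) A dualLineProj p

/-- The smooth sections of `𝒯^E(E^* × ℝ) → E^* × ℝ`. -/
abbrev HamSection : Type _ :=
  ProlSection (dualLineModel B F) A (dualLineProj : DualLine F E → Q)

variable (B) in
/-- The Liouville `1`-section `Θ_{(b, s)}(a, v) = b(a)`. -/
def liouville (p : DualLine F E) :
    (E (dualLineProj p) × TangentSpace (dualLineModel B F) p) →ₗ[ℝ] ℝ :=
  (p.1.snd : E p.1.proj →ₗ[ℝ] ℝ).comp (LinearMap.fst ℝ _ _)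

variable (B) in
/-- The contact `1`-section `η = 𝒱^s - Θ`, where `𝒱^s(a, v) = ds(v)`, for `s : E^* × ℝ → ℝ` the
second projection. -/
def contactForm (p : DualLine F E) :
    (E (dualLineProj p) × TangentSpace (dualLineModel B F) p) →ₗ[ℝ] ℝ :=
  (mfderiv (dualLineModel B F) 𝓘(ℝ, ℝ) (fun p' : DualLine F E ↦ p'.2) p).toLinearMap.comp
      (LinearMap.snd ℝ _ _)
    - liouville B p

variable {A}

/-- `R` is the Reeb section of `(𝒯^E(E^* × ℝ), η)`: `i_R dη = 0` and `i_R η = 1`. -/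
structure IsReebSection [FiniteDimensional ℝ B] [T2Space Q] (R : HamSection A) : Prop where
  extDeriv_eq : ∀ (Z : HamSection A) (p : DualLine F E), extDerivOne (contactForm B) R Z p = 0
  contactForm_eq : ∀ p : DualLine F E, contactForm B p (R.toFun p) = 1

/-- `ξ` is the Hamiltonian section of the function `H`, where `R` is the Reeb section:
`i_ξ η = -H` and `i_ξ dη = dH - ρ(R)(H) η`. -/
structure IsHamiltonianSection [FiniteDimensional ℝ B] [T2Space Q]
    (R : HamSection A) (H : DualLine F E → ℝ) (ξ : HamSection A) : Prop where
  contactForm_eq : ∀ p : DualLine F E, contactForm B p (ξ.toFun p) = -H p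
  extDeriv_eq : ∀ (Z : HamSection A) (p : DualLine F E),
    extDerivOne (contactForm B) ξ Z p =
      dirDeriv (dualLineModel B F) H p (Z.vec p)
        - dirDeriv (dualLineModel B F) H p (R.vec p) * contactForm B p (Z.toFun p)

/-- The section `γ = (γ₀, γₛ) : Q → E^* × ℝ` given by a section `γ₀` of `E^*` and a function `γₛ`. -/
def gammaMap (γ₀ : Cₛ^∞⟮𝓘(ℝ, B); F →L[ℝ] ℝ, fun q ↦ E q →L[ℝ] ℝ⟯)
    (γₛ : C^∞⟮𝓘(ℝ, B), Q; 𝓘(ℝ, ℝ), ℝ⟯) (q : Q) : DualLine F E :=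
  (⟨q, γ₀ q⟩, γₛ q)

variable (A) (γ₀ : Cₛ^∞⟮𝓘(ℝ, B); F →L[ℝ] ℝ, fun q ↦ E q →L[ℝ] ℝ⟯)
  (γₛ : C^∞⟮𝓘(ℝ, B), Q; 𝓘(ℝ, ℝ), ℝ⟯)

theorem contMDiff_gammaMap : ContMDiff 𝓘(ℝ, B) (dualLineModel B F) ∞ (gammaMap γ₀ γₛ) :=
  γ₀.contMDiff.prodMk γₛ.contMDiff

theorem mfderiv_proj_gammaMap (q : Q) (v : TangentSpace 𝓘(ℝ, B) q) :
    mfderiv (dualLineModel B F) 𝓘(ℝ, B) (dualLineProj : DualLine F E → Q) (gammaMap γ₀ γₛ q)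
      (mfderiv 𝓘(ℝ, B) (dualLineModel B F) (gammaMap γ₀ γₛ) q v) = v := by
  have h₁ : MDifferentiableAt (dualLineModel B F) 𝓘(ℝ, B) (dualLineProj : DualLine F E → Q)
      (gammaMap γ₀ γₛ q) :=
    (((contMDiff_proj (n := ∞) (fun q ↦ E q →L[ℝ] ℝ)).comp contMDiff_fst).mdifferentiable
      (by simp)) _
  have h₂ : MDifferentiableAt 𝓘(ℝ, B) (dualLineModel B F) (gammaMap γ₀ γₛ) q :=
    (contMDiff_gammaMap γ₀ γₛ).mdifferentiable (by simp) q
  have h₃ := mfderiv_comp q h₁ h₂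
  have h₄ : (dualLineProj : DualLine F E → Q) ∘ gammaMap γ₀ γₛ = id := rfl
  rw [h₄, mfderiv_id] at h₃
  exact (DFunLike.congr_fun h₃ v).symm

/-- The map `(Id_E, Tγ ∘ ρ) : E_q → 𝒯^E(E^* × ℝ)_{γ(q)}`, `a ↦ (a, Tγ(ρ(a)))`. -/
def gammaLift (q : Q) : E q →ₗ[ℝ] HamFiber A (gammaMap γ₀ γₛ q) :=
  LinearMap.codRestrict (prolFiber (dualLineModel B F) A dualLineProj (gammaMap γ₀ γₛ q))
    (LinearMap.id.prod
      ((mfderiv 𝓘(ℝ, B) (dualLineModel B F) (gammaMap γ₀ γₛ) q).toLinearMap.comp (A.anchor q)))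
    (fun a ↦ (mfderiv_proj_gammaMap γ₀ γₛ q (A.anchor q a)).symm)

/-- The fibre at `γ(q)` of `F_γ = {(a, Tγ(ρ(a))) | a ∈ E}`, a subbundle of `𝒯^E(E^* × ℝ)` along the
submanifold `γ(Q)`, which is parametrized by `γ : Q → E^* × ℝ`. -/
def gammaSub (q : Q) : Submodule ℝ (HamFiber A (gammaMap γ₀ γₛ q)) :=
  LinearMap.range (gammaLift A γ₀ γₛ q)

/-- `γ = (γ₀, γₛ)` is locally the `1`-jet `j¹f = (d^E f, f)` of a function `f` on `Q`, where
`d^E f(a) = ρ(a) f`. -/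
def IsLocallyOneJet : Prop :=
  ∀ q₀ : Q, ∃ (U : Set Q) (f : Q → ℝ), IsOpen U ∧ q₀ ∈ U ∧ ContMDiffOn 𝓘(ℝ, B) 𝓘(ℝ, ℝ) ∞ f U ∧
    ∀ q ∈ U, γₛ q = f q ∧ ∀ a : E q, γ₀ q a = dirDeriv 𝓘(ℝ, B) f q (A.anchor q a)

variable {A}

/-- The section `ξ^γ = pr₁ ∘ ξ ∘ γ` of `E` induced by a section `ξ` of `𝒯^E(E^* × ℝ)`. -/
def inducedSection (ξ : HamSection A) : Cₛ^∞⟮𝓘(ℝ, B); F, E⟯ where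
  toFun q := (ξ.toFun (gammaMap γ₀ γₛ q)).1.1
  contMDiff_toFun := ξ.contMDiff_fst.comp (contMDiff_gammaMap γ₀ γₛ)

/-- `ξ` and the section `σ` of `E` are `γ`-related: `ξ ∘ γ = (Id_E, Tγ ∘ ρ) ∘ σ`. -/
def GammaRelated (ξ : HamSection A) (σ : Cₛ^∞⟮𝓘(ℝ, B); F, E⟯) : Prop :=
  ∀ q : Q, ξ.toFun (gammaMap γ₀ γₛ q) = gammaLift A γ₀ γₛ q (σ q)

end Hamiltonian

end Algebroid

end ContactAlgebroid

end

/-!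
On `F_γ` the contact form is `dγₛ ∘ ρ - γ₀`, so `F_γ` is isotropic exactly when `γ = j¹γₛ`. As `ρ`
maps brackets of sections to commutators of derivations, `dη` vanishes on `F_γ` too. An element of
the fibre of `𝒯^E(E^* × ℝ)` at `γ(q)` is determined by its `E`-component, by `η`, and by `dη`
against `F_γ`. If `H ∘ γ = 0`, then `dH` vanishes on `γ(Q)`, and the Hamiltonian equations give
`ξ_H(γ(q))` and `(a, Tγ(ρ(a)))`, with `a` the `E`-component of the former, the same such data.
Conversely `γ`-relatedness puts `ξ_H ∘ γ` in `F_γ`, whence `H ∘ γ = -η(ξ_H ∘ γ) = 0`.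
-/

noncomputable section

namespace ContactAlgebroid

section Manifold

open VectorField

variable {EM HM M W : Type*} [NormedAddCommGroup EM] [NormedSpace ℝ EM]
  [TopologicalSpace HM] {I : ModelWithCorners ℝ EM HM} [TopologicalSpace M] [ChartedSpace HM M]
  [NormedAddCommGroup W] [NormedSpace ℝ W]

theorem dirDeriv_const (c : W) (x : M) (v : TangentSpace I x) :
    dirDeriv I (fun _ ↦ c) x v = 0 := by
  rw [dirDeriv, mfderiv_const]
  rfl

theorem dirDeriv_congr {f g : M → W} {x : M} (h : f =ᶠ[𝓝 x] g) (v : TangentSpace I x) :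
    dirDeriv I f x v = dirDeriv I g x v :=
  DFunLike.congr_fun h.mfderiv_eq v

theorem dirDeriv_comp_mfderiv {EN HN N : Type*} [NormedAddCommGroup EN] [NormedSpace ℝ EN]
    [TopologicalSpace HN] {J : ModelWithCorners ℝ EN HN} [TopologicalSpace N] [ChartedSpace HN N]
    {g : N → W} {f : M → N} {x : M} (hg : MDifferentiableAt J 𝓘(ℝ, W) g (f x))
    (hf : MDifferentiableAt I J f x) (v : TangentSpace I x) :
    dirDeriv I (g ∘ f) x v = dirDeriv J g (f x) (mfderiv I J f x v) :=
  DFunLike.congr_fun (mfderiv_comp x hg hf) v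

theorem dirDeriv_clm_apply {V : Type*} [NormedAddCommGroup V] [NormedSpace ℝ V]
    {g : M → V →L[ℝ] W} {c : M → V} {x : M} (hg : MDifferentiableAt I 𝓘(ℝ, V →L[ℝ] W) g x)
    (hc : MDifferentiableAt I 𝓘(ℝ, V) c x) (v : TangentSpace I x) :
    dirDeriv I (fun y ↦ g y (c y)) x v = dirDeriv I g x v (c x) + g x (dirDeriv I c x v) := by
  have hpair : HasMFDerivAt I 𝓘(ℝ, (V →L[ℝ] W) × V) (fun y ↦ (g y, c y)) x
      ((mfderiv I 𝓘(ℝ, V →L[ℝ] W) g x).prod (mfderiv I 𝓘(ℝ, V) c x)) :=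
    ⟨hg.continuousAt.prodMk hc.continuousAt, hg.hasMFDerivAt.2.prodMk hc.hasMFDerivAt.2⟩
  have heval : HasMFDerivAt 𝓘(ℝ, (V →L[ℝ] W) × V) 𝓘(ℝ, W)
      (fun y : (V →L[ℝ] W) × V ↦ y.1 y.2) (g x, c x) _ :=
    (hasFDerivAt_fst.clm_apply hasFDerivAt_snd).hasMFDerivAt
  exact (DFunLike.congr_fun (heval.comp x hpair).mfderiv v).trans (add_comm _ _)

theorem contMDiff_dirDeriv [IsManifold I ∞ M] {f : M → W} (hf : ContMDiff I 𝓘(ℝ, W) ∞ f)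
    {X : ∀ x : M, TangentSpace I x}
    (hX : ContMDiff I I.tangent ∞ (fun x ↦ (⟨x, X x⟩ : TangentBundle I M))) :
    ContMDiff I 𝓘(ℝ, W) ∞ (fun x ↦ dirDeriv I f x (X x)) :=
  (contMDiff_snd_tangentBundle_modelSpace (E := W) (I := 𝓘(ℝ, W))).comp
    ((hf.contMDiff_tangentMap (m := ∞) (by simp)).comp hX)

theorem contMDiff_prodMk_vectorField [IsManifold I 1 M] {EN HN N : Type*}
    [NormedAddCommGroup EN] [NormedSpace ℝ EN] [TopologicalSpace HN]
    {J : ModelWithCorners ℝ EN HN} [TopologicalSpace N] [ChartedSpace HN N] [IsManifold J 1 N]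
    {n : WithTop ℕ∞}
    {X : ∀ x : M, TangentSpace I x} {Y : ∀ y : N, TangentSpace J y}
    (hX : ContMDiff I I.tangent n (fun x ↦ (⟨x, X x⟩ : TangentBundle I M)))
    (hY : ContMDiff J J.tangent n (fun y ↦ (⟨y, Y y⟩ : TangentBundle J N))) :
    ContMDiff (I.prod J) (I.prod J).tangent n
      (fun p : M × N ↦ (⟨p, (X p.1, Y p.2)⟩ : TangentBundle (I.prod J) (M × N))) :=
  contMDiff_equivTangentBundleProd_symm.comp
    ((hX.comp contMDiff_fst).prodMk (hY.comp contMDiff_snd))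

theorem dirDeriv_eq_fderivWithin_extChartAt [IsManifold I 1 M] {f : M → W} {g : EM → W} {x y : M}
    (hy : y ∈ (extChartAt I x).source)
    (hg : DifferentiableWithinAt ℝ g (range I) (extChartAt I x y))
    (hf : f =ᶠ[𝓝 y] g ∘ extChartAt I x) (v : TangentSpace I y) :
    dirDeriv I f y v =
      fderivWithin ℝ g (range I) (extChartAt I x y) (mfderiv I 𝓘(ℝ, EM) (extChartAt I x) y v) := by
  have hφ : HasMFDerivWithinAt I 𝓘(ℝ, EM) (extChartAt I x) univ y _ :=
    (mdifferentiableAt_extChartAt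
      (by rwa [extChartAt_source] at hy)).hasMFDerivAt.hasMFDerivWithinAt
  have hcomp := hg.hasFDerivWithinAt.hasMFDerivWithinAt.comp y hφ
    fun z _ ↦ mem_range_self (chartAt HM x z)
  exact DFunLike.congr_fun ((hasMFDerivWithinAt_univ.1 hcomp).congr_of_eventuallyEq hf).mfderiv v

theorem eventually_mfderiv_extChartAt_apply [IsManifold I 1 M] (X : ∀ y : M, TangentSpace I y)
    (x : M) :
    ∀ᶠ y in 𝓝 x, mfderiv I 𝓘(ℝ, EM) (extChartAt I x) y (X y) =
      mpullbackWithin 𝓘(ℝ, EM) I (extChartAt I x).symm X (range I) (extChartAt I x y) := by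
  have hX := eventuallyEq_mpullback_mpullbackWithin_extChartAt (s := univ) (x := x) X
  rw [nhdsWithin_univ] at hX
  filter_upwards [hX, extChartAt_source_mem_nhds (I := I) x] with y hXy hy
  exact (congrArg _ hXy).trans ((isInvertible_mfderiv_extChartAt hy).self_apply_inverse _)

theorem differentiableWithinAt_mpullbackWithin_extChartAt_symm [CompleteSpace EM]
    [IsManifold I 2 M] {X : ∀ y : M, TangentSpace I y} {x : M}
    (hX : MDifferentiableAt I I.tangent (fun y ↦ (⟨y, X y⟩ : TangentBundle I M)) x) :
    DifferentiableWithinAt ℝ (mpullbackWithin 𝓘(ℝ, EM) I (extChartAt I x).symm X (range I))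
      (range I) (extChartAt I x x) := by
  have h := (mdifferentiableWithinAt_univ.2 hX).differentiableWithinAt_mpullbackWithin_vectorField
  rwa [preimage_univ, univ_inter] at h

theorem eventually_dirDeriv_eq_fderivWithin [IsManifold I 1 M] {f : M → W} {x : M}
    (hf : ContMDiffAt I 𝓘(ℝ, W) 1 f x) (X : ∀ y : M, TangentSpace I y) :
    ∀ᶠ y in 𝓝 x, dirDeriv I f y (X y) =
      fderivWithin ℝ (f ∘ (extChartAt I x).symm) (range I) (extChartAt I x y)
        (mpullbackWithin 𝓘(ℝ, EM) I (extChartAt I x).symm X (range I) (extChartAt I x y)) := by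
  have hφ : Tendsto (extChartAt I x) (𝓝 x) (𝓝[range I] extChartAt I x x) :=
    (map_extChartAt_nhds x).le
  have hg : ContDiffWithinAt ℝ 1 (f ∘ (extChartAt I x).symm) (range I) (extChartAt I x x) :=
    (contMDiffAt_iff_source.1 hf).contDiffWithinAt
  have hx : extChartAt I x x ∈ range I := mem_range_self _
  have hgd := hg.eventually (by simp)
  rw [insert_eq_of_mem hx] at hgd
  filter_upwards [hφ.eventually hgd, eventually_mfderiv_extChartAt_apply X x,
    extChartAt_source_mem_nhds (I := I) x] with y hgy hXy hy
  have hfy : f =ᶠ[𝓝 y] (f ∘ (extChartAt I x).symm) ∘ extChartAt I x := by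
    filter_upwards [extChartAt_source_mem_nhds' hy] with z hz
    exact congrArg f ((extChartAt I x).left_inv hz).symm
  rw [dirDeriv_eq_fderivWithin_extChartAt hy (hgy.differentiableWithinAt one_ne_zero) hfy, hXy]

theorem dirDeriv_dirDeriv_eq_fderivWithin [CompleteSpace EM] [IsManifold I 2 M]
    {f : M → W} {x : M} (hf : ContMDiffAt I 𝓘(ℝ, W) 2 f x) {X Y : ∀ y : M, TangentSpace I y}
    (hY : MDifferentiableAt I I.tangent (fun y ↦ (⟨y, Y y⟩ : TangentBundle I M)) x) :
    dirDeriv I (fun y ↦ dirDeriv I f y (Y y)) x (X x) =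
      fderivWithin ℝ (fun e ↦ fderivWithin ℝ (f ∘ (extChartAt I x).symm) (range I) e
          (mpullbackWithin 𝓘(ℝ, EM) I (extChartAt I x).symm Y (range I) e)) (range I)
        (extChartAt I x x)
        (mpullbackWithin 𝓘(ℝ, EM) I (extChartAt I x).symm X (range I) (extChartAt I x x)) := by
  have : IsManifold I 1 M := .of_le (n := 2) (by norm_num)
  have hg : ContDiffWithinAt ℝ 2 (f ∘ (extChartAt I x).symm) (range I) (extChartAt I x x) :=
    (contMDiffAt_iff_source.1 hf).contDiffWithinAt
  have hdg := (hg.fderivWithin_right (m := 1) I.uniqueDiffOn (by norm_num)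
    (mem_range_self _)).differentiableWithinAt one_ne_zero
  rw [dirDeriv_eq_fderivWithin_extChartAt (mem_extChartAt_source x)
    (hdg.clm_apply (differentiableWithinAt_mpullbackWithin_extChartAt_symm hY))
    (eventually_dirDeriv_eq_fderivWithin (hf.of_le (by norm_num)) Y),
    (eventually_mfderiv_extChartAt_apply X x).self_of_nhds]

theorem dirDeriv_mlieBracket [CompleteSpace EM] [IsManifold I 2 M] {f : M → W} {x : M}
    (hf : ContMDiffAt I 𝓘(ℝ, W) 2 f x) {X Y : ∀ y : M, TangentSpace I y}
    (hX : MDifferentiableAt I I.tangent (fun y ↦ (⟨y, X y⟩ : TangentBundle I M)) x)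
    (hY : MDifferentiableAt I I.tangent (fun y ↦ (⟨y, Y y⟩ : TangentBundle I M)) x) :
    dirDeriv I f x (mlieBracket I X Y x) =
      dirDeriv I (fun y ↦ dirDeriv I f y (Y y)) x (X x) -
        dirDeriv I (fun y ↦ dirDeriv I f y (X y)) x (Y x) := by
  have : IsManifold I 1 M := .of_le (n := 2) (by norm_num)
  have hg : ContDiffWithinAt ℝ 2 (f ∘ (extChartAt I x).symm) (range I) (extChartAt I x x) :=
    (contMDiffAt_iff_source.1 hf).contDiffWithinAt
  rw [dirDeriv_dirDeriv_eq_fderivWithin hf hX, dirDeriv_dirDeriv_eq_fderivWithin hf hY,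
    ← fderivWithin_apply_lieBracket hg minSmoothness_of_isRCLikeNormedField.le I.uniqueDiffOn
      (I.range_subset_closure_interior (mem_range_self _)) (mem_range_self _)
      (differentiableWithinAt_mpullbackWithin_extChartAt_symm hY)
      (differentiableWithinAt_mpullbackWithin_extChartAt_symm hX),
    (eventually_dirDeriv_eq_fderivWithin (hf.of_le (by norm_num)) _).self_of_nhds,
    ← (eventually_mfderiv_extChartAt_apply _ x).self_of_nhds]
  congr 1
  refine ((isInvertible_mfderiv_extChartAt (mem_extChartAt_source x)).self_apply_inverse _).trans ?_
  rw [preimage_univ, univ_inter]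

end Manifold

section Algebroid

variable {B : Type*} [NormedAddCommGroup B] [NormedSpace ℝ B]
  {Q : Type*} [TopologicalSpace Q] [ChartedSpace B Q]
  {F : Type*} [NormedAddCommGroup F] [NormedSpace ℝ F]
  {E : Q → Type*} [∀ q, AddCommGroup (E q)] [∀ q, Module ℝ (E q)] [∀ q, TopologicalSpace (E q)]
  [TopologicalSpace (TotalSpace F E)] [FiberBundle F E] [VectorBundle ℝ F E]

section DualLine

open VectorField

/-- The fibre coordinate in `F^*` of a point of `E^* × ℝ`, in the preferred trivialization of `E`
at `q`. -/
def momentum (q : Q) (p : DualLine F E) : F →L[ℝ] ℝ :=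
  (trivializationAt (F →L[ℝ] ℝ) (fun q ↦ E q →L[ℝ] ℝ) q p.1).2

theorem momentum_apply {q : Q} {p : DualLine F E}
    (hp : dualLineProj p ∈ (trivializationAt F E q).baseSet) (z : F) :
    momentum q p z = p.1.snd ((trivializationAt F E q).symm (dualLineProj p) z) := by
  rw [momentum, hom_trivializationAt_apply]
  simp [ContinuousLinearMap.inCoordinates, Trivialization.symmL_apply (R := ℝ) _ hp]

theorem momentum_apply_trivializationAt {q : Q} {p : DualLine F E}
    (hp : dualLineProj p ∈ (trivializationAt F E q).baseSet) (a : E (dualLineProj p)) :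
    momentum q p (trivializationAt F E q ⟨dualLineProj p, a⟩).2 = p.1.snd a := by
  rw [momentum_apply hp, Trivialization.symm_apply_apply_mk _ hp]

/-- The bundle chart `(π, momentum q, s)` of `E^* × ℝ` induced by the preferred trivialization of
`E` at `q`. -/
def dualLineChart (q : Q) : OpenPartialHomeomorph (DualLine F E) ((Q × (F →L[ℝ] ℝ)) × ℝ) :=
  (trivializationAt (F →L[ℝ] ℝ) (fun q ↦ E q →L[ℝ] ℝ) q).toOpenPartialHomeomorph.prod
    (OpenPartialHomeomorph.refl ℝ)

theorem mem_dualLineChart_source {q : Q} {p : DualLine F E} :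
    p ∈ (dualLineChart q).source ↔ dualLineProj p ∈ (trivializationAt F E q).baseSet := by
  simp [dualLineChart]

theorem dualLineChart_apply {q : Q} {p : DualLine F E}
    (hp : dualLineProj p ∈ (trivializationAt F E q).baseSet) :
    dualLineChart q p = ((dualLineProj p, momentum q p), p.2) :=
  Prod.ext (Prod.ext (congrArg (·.1.1) ((dualLineChart q).left_inv
    (mem_dualLineChart_source.2 hp))) rfl) rfl

theorem contMDiff_dualLineProj :
    ContMDiff (dualLineModel B F) 𝓘(ℝ, B) ∞ (dualLineProj : DualLine F E → Q) :=
  (contMDiff_proj _).comp contMDiff_fst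

theorem contactForm_apply {p : DualLine F E}
    (z : E (dualLineProj p) × TangentSpace (dualLineModel B F) p) :
    contactForm B p z =
      dirDeriv (dualLineModel B F) (Prod.snd : DualLine F E → ℝ) p z.2 - p.1.snd z.1 :=
  rfl

variable [ContMDiffVectorBundle ∞ F E 𝓘(ℝ, B)]

theorem contMDiffOn_dualLineChart (q : Q) : ContMDiffOn (dualLineModel B F) (dualLineModel B F) ∞
    (dualLineChart q) (dualLineChart q : OpenPartialHomeomorph (DualLine F E) _).source :=
  ((Trivialization.contMDiffOn _).comp contMDiffOn_fst fun _ hp ↦ hp.1).prodMk contMDiffOn_snd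

theorem contMDiffOn_dualLineChart_symm (q : Q) :
    ContMDiffOn (dualLineModel B F) (dualLineModel B F) ∞
      (dualLineChart q : OpenPartialHomeomorph (DualLine F E) _).symm
      (dualLineChart q : OpenPartialHomeomorph (DualLine F E) _).target :=
  ((trivializationAt (F →L[ℝ] ℝ) (fun q ↦ E q →L[ℝ] ℝ) q).contMDiffOn_symm.comp
    contMDiffOn_fst fun _ hy ↦ hy.1).prodMk contMDiffOn_snd

theorem mdifferentiable_dualLineChart (q : Q) :
    (dualLineChart q : OpenPartialHomeomorph (DualLine F E) _).MDifferentiable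
      (dualLineModel B F) (dualLineModel B F) :=
  ⟨(contMDiffOn_dualLineChart q).mdifferentiableOn (by simp),
    (contMDiffOn_dualLineChart_symm q).mdifferentiableOn (by simp)⟩

theorem mdifferentiableAt_momentum {q : Q} {p : DualLine F E}
    (hp : dualLineProj p ∈ (trivializationAt F E q).baseSet) :
    MDifferentiableAt (dualLineModel B F) 𝓘(ℝ, F →L[ℝ] ℝ) (momentum q) p :=
  mdifferentiableAt_snd.comp p (mdifferentiableAt_fst.comp p
    ((mdifferentiable_dualLineChart q).mdifferentiableAt (mem_dualLineChart_source.2 hp)))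

theorem isInvertible_mfderiv_dualLineChart {q : Q} {p : DualLine F E}
    (hp : dualLineProj p ∈ (trivializationAt F E q).baseSet) :
    (mfderiv (dualLineModel B F) (dualLineModel B F) (dualLineChart q) p).IsInvertible :=
  ⟨(mdifferentiable_dualLineChart q).mfderiv (mem_dualLineChart_source.2 hp), rfl⟩

theorem mfderiv_dualLineChart_apply {q : Q} {p : DualLine F E}
    (hp : dualLineProj p ∈ (trivializationAt F E q).baseSet)
    (v : TangentSpace (dualLineModel B F) p) :
    mfderiv (dualLineModel B F) (dualLineModel B F) (dualLineChart q) p v =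
      ((mfderiv (dualLineModel B F) 𝓘(ℝ, B) (dualLineProj : DualLine F E → Q) p v,
        dirDeriv (dualLineModel B F) (momentum q) p v),
        dirDeriv (dualLineModel B F) (Prod.snd : DualLine F E → ℝ) p v) := by
  have hcoord : dualLineChart q =ᶠ[𝓝 p]
      fun p' : DualLine F E ↦ ((dualLineProj p', momentum q p'), p'.2) := by
    filter_upwards [(dualLineChart q).open_source.mem_nhds (mem_dualLineChart_source.2 hp)]
      with p' hp'
    exact dualLineChart_apply (mem_dualLineChart_source.1 hp')
  have hproj := (contMDiff_dualLineProj (B := B) (F := F) (E := E)).mdifferentiable (by simp) p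
  have hs : MDifferentiableAt (dualLineModel B F) 𝓘(ℝ, ℝ) (Prod.snd : DualLine F E → ℝ) p :=
    mdifferentiableAt_snd
  have h := (hproj.hasMFDerivAt.prodMk (mdifferentiableAt_momentum hp).hasMFDerivAt).prodMk
    hs.hasMFDerivAt
  exact DFunLike.congr_fun (h.congr_of_eventuallyEq hcoord).mfderiv v

theorem dualLine_tangent_ext {q : Q} {p : DualLine F E}
    (hp : dualLineProj p ∈ (trivializationAt F E q).baseSet)
    {v w : TangentSpace (dualLineModel B F) p}
    (hproj : mfderiv (dualLineModel B F) 𝓘(ℝ, B) (dualLineProj : DualLine F E → Q) p v =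
      mfderiv (dualLineModel B F) 𝓘(ℝ, B) (dualLineProj : DualLine F E → Q) p w)
    (hmom : dirDeriv (dualLineModel B F) (momentum q) p v =
      dirDeriv (dualLineModel B F) (momentum q) p w)
    (hs : dirDeriv (dualLineModel B F) (Prod.snd : DualLine F E → ℝ) p v =
      dirDeriv (dualLineModel B F) (Prod.snd : DualLine F E → ℝ) p w) : v = w := by
  apply (mdifferentiable_dualLineChart q).mfderiv_injective (mem_dualLineChart_source.2 hp)
  rw [mfderiv_dualLineChart_apply hp, mfderiv_dualLineChart_apply hp, hproj, hmom, hs]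

/-- The vector field on the domain of `dualLineChart q` with coordinates `(X ∘ π, β, s)`, for a
vector field `X` on `Q` and constants `β`, `s`. -/
def dualLineLift (X : ∀ x : Q, TangentSpace 𝓘(ℝ, B) x) (q : Q) (β : F →L[ℝ] ℝ) (s : ℝ) :
    ∀ p : DualLine F E, TangentSpace (dualLineModel B F) p :=
  mpullback (dualLineModel B F) (dualLineModel B F) (dualLineChart q) fun y ↦ ((X y.1.1, β), s)

theorem mfderiv_dualLineChart_dualLineLift (X : ∀ x : Q, TangentSpace 𝓘(ℝ, B) x) {q : Q}
    {p : DualLine F E} (hp : dualLineProj p ∈ (trivializationAt F E q).baseSet)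
    (β : F →L[ℝ] ℝ) (s : ℝ) :
    mfderiv (dualLineModel B F) (dualLineModel B F) (dualLineChart q) p
      (dualLineLift X q β s p) = ((X (dualLineProj p), β), s) := by
  refine ((isInvertible_mfderiv_dualLineChart hp).self_apply_inverse _).trans ?_
  rw [dualLineChart_apply hp]
  rfl

theorem contMDiffOn_dualLineLift [FiniteDimensional ℝ B] [IsManifold 𝓘(ℝ, B) ∞ Q]
    {X : ∀ x : Q, TangentSpace 𝓘(ℝ, B) x}
    (hX : ContMDiff 𝓘(ℝ, B) 𝓘(ℝ, B).tangent ∞ (fun x ↦ (⟨x, X x⟩ : TangentBundle 𝓘(ℝ, B) Q)))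
    (q : Q) (β : F →L[ℝ] ℝ) (s : ℝ) :
    ContMDiffOn (dualLineModel B F) (dualLineModel B F).tangent ∞
      (fun p ↦ (⟨p, dualLineLift X q β s p⟩ : TangentBundle (dualLineModel B F) (DualLine F E)))
      (dualLineProj ⁻¹' (trivializationAt F E q).baseSet) := by
  intro p hp
  have hβ : ContMDiff 𝓘(ℝ, F →L[ℝ] ℝ) 𝓘(ℝ, F →L[ℝ] ℝ).tangent ∞
      (fun m ↦ (⟨m, β⟩ : TangentBundle 𝓘(ℝ, F →L[ℝ] ℝ) (F →L[ℝ] ℝ))) :=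
    contMDiff_vectorSpace_iff_contDiff.2 contDiff_const
  have hs : ContMDiff 𝓘(ℝ, ℝ) 𝓘(ℝ, ℝ).tangent ∞ (fun t ↦ (⟨t, s⟩ : TangentBundle 𝓘(ℝ, ℝ) ℝ)) :=
    contMDiff_vectorSpace_iff_contDiff.2 contDiff_const
  have : CompleteSpace B := FiniteDimensional.complete ℝ B
  exact (ContMDiffAt.mpullback_vectorField_preimage
    ((contMDiff_prodMk_vectorField (contMDiff_prodMk_vectorField hX hβ) hs).contMDiffAt)
    ((contMDiffOn_dualLineChart q).contMDiffAt ((dualLineChart q).open_source.mem_nhds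
      (mem_dualLineChart_source.2 hp)))
    (isInvertible_mfderiv_dualLineChart hp) (by simp)).contMDiffWithinAt

end DualLine

theorem smulSection_apply (f : C^∞⟮𝓘(ℝ, B), Q; 𝓘(ℝ, ℝ), ℝ⟯) (σ : Cₛ^∞⟮𝓘(ℝ, B); F, E⟯) (q : Q) :
    smulSection f σ q = f q • σ q :=
  rfl

variable [IsManifold 𝓘(ℝ, B) ∞ Q]

namespace LieAlgebroid

variable (A : LieAlgebroid B F E) (σ τ ν : Cₛ^∞⟮𝓘(ℝ, B); F, E⟯)
  (f : C^∞⟮𝓘(ℝ, B), Q; 𝓘(ℝ, ℝ), ℝ⟯)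

theorem contMDiff_anchor_section : ContMDiff 𝓘(ℝ, B) 𝓘(ℝ, B).tangent ∞
    (fun q ↦ (⟨q, A.anchor q (σ q)⟩ : TangentBundle 𝓘(ℝ, B) Q)) :=
  A.contMDiff_anchor.comp σ.contMDiff

/-- The Lie derivative `ρ(σ) f` of a smooth function `f` along a section `σ` of a Lie algebroid. -/
def lieDeriv : C^∞⟮𝓘(ℝ, B), Q; 𝓘(ℝ, ℝ), ℝ⟯ :=
  ⟨fun q ↦ dirDeriv 𝓘(ℝ, B) f q (A.anchor q (σ q)),
    contMDiff_dirDeriv f.contMDiff (A.contMDiff_anchor_section σ)⟩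

theorem lieDeriv_apply (q : Q) :
    A.lieDeriv σ f q = dirDeriv 𝓘(ℝ, B) f q (A.anchor q (σ q)) :=
  rfl

theorem bracket_smulSection : A.bracket σ (smulSection f τ) =
    smulSection f (A.bracket σ τ) + smulSection (A.lieDeriv σ f) τ := by
  ext q
  exact A.leibniz f σ τ q

theorem bracket_neg : A.bracket σ (-τ) = -A.bracket σ τ := by
  simpa only [neg_one_smul] using A.bracket_smul_right (-1) σ τ

theorem bracket_bracket :
    A.bracket (A.bracket σ τ) ν = A.bracket σ (A.bracket τ ν) - A.bracket τ (A.bracket σ ν) := by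
  have h := A.jacobi σ τ ν
  rw [A.bracket_skew ν σ, A.bracket_neg, A.bracket_skew ν (A.bracket σ τ), ← sub_eq_add_neg,
    ← sub_eq_add_neg] at h
  exact (sub_eq_zero.1 h).symm

-- Expand `⟦⟦σ, τ⟧, f ν⟧` by the Leibniz rule and by the Jacobi identity.
theorem lieDeriv_bracket_smul (q : Q) :
    A.lieDeriv (A.bracket σ τ) f q • ν q =
      (A.lieDeriv σ (A.lieDeriv τ f) q - A.lieDeriv τ (A.lieDeriv σ f) q) • ν q := by
  have h := A.bracket_bracket σ τ (smulSection f ν)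
  simp only [A.bracket_smulSection, A.bracket_add_right, A.bracket_bracket σ τ ν] at h
  replace h := DFunLike.congr_fun h q
  simp only [ContMDiffSection.coe_add, ContMDiffSection.coe_sub, Pi.add_apply, Pi.sub_apply,
    smulSection_apply, smul_sub] at h
  rw [← sub_eq_zero] at h ⊢
  rw [← h]
  module

theorem lieDeriv_bracket : A.lieDeriv (A.bracket σ τ) f =
    A.lieDeriv σ (A.lieDeriv τ f) - A.lieDeriv τ (A.lieDeriv σ f) := by
  ext q
  simp only [ContMDiffMap.coe_sub, Pi.sub_apply]
  by_cases hν : ∃ ν : Cₛ^∞⟮𝓘(ℝ, B); F, E⟯, ν q ≠ 0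
  · obtain ⟨ν, hν⟩ := hν
    exact smul_left_injective ℝ hν (A.lieDeriv_bracket_smul σ τ ν f q)
  · have hzero : ∀ (s : Cₛ^∞⟮𝓘(ℝ, B); F, E⟯) g, A.lieDeriv s g q = 0 := by
      intro s g
      rw [lieDeriv_apply, not_not.1 (not_exists.1 hν s), map_zero]
      exact map_zero _
    simp only [hzero, sub_zero]

end LieAlgebroid

section ConstSection

variable [FiniteDimensional ℝ B] [T2Space Q] [ContMDiffVectorBundle ∞ F E 𝓘(ℝ, B)]

theorem eventually_constSection_apply (q : Q) (a : E q) :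
    ∀ᶠ x in 𝓝 q, (constSection (B := B) (F := F) q a) x =
      (trivializationAt F E q).symm x (trivializationAt F E q ⟨q, a⟩).2 :=
  (exists_constSection q a).choose_spec

theorem constSection_self (q : Q) (a : E q) : constSection (B := B) (F := F) q a q = a := by
  rw [(eventually_constSection_apply q a).self_of_nhds, Trivialization.symm_apply_apply_mk]
  exact FiberBundle.mem_baseSet_trivializationAt' q

end ConstSection

namespace ProlSection

variable {EP : Type*} [NormedAddCommGroup EP] [NormedSpace ℝ EP] {HP : Type*} [TopologicalSpace HP]
  {IP : ModelWithCorners ℝ EP HP} {P : Type*} [TopologicalSpace P] [ChartedSpace HP P]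
  [IsManifold IP ∞ P] {A : LieAlgebroid B F E} {prj : P → Q}

/-- The coefficients `(Z^α)` of the `E`-component of a section `Z` of the prolongation, in the
preferred trivialization of `E` at `q`. -/
def coeff (Z : ProlSection IP A prj) (q : Q) (p : P) : F :=
  (trivializationAt F E q ⟨prj p, Z.fst p⟩).2

theorem mdifferentiableAt_coeff [ContMDiffVectorBundle ∞ F E 𝓘(ℝ, B)] (Z : ProlSection IP A prj)
    {q : Q} {p : P} (hp : prj p ∈ (trivializationAt F E q).baseSet) :
    MDifferentiableAt IP 𝓘(ℝ, F) (Z.coeff q) p := by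
  have he : ContMDiffAt (𝓘(ℝ, B).prod 𝓘(ℝ, F)) (𝓘(ℝ, B).prod 𝓘(ℝ, F)) ∞ (trivializationAt F E q)
      (⟨prj p, Z.fst p⟩ : TotalSpace F E) :=
    (trivializationAt F E q).contMDiffOn.contMDiffAt
      ((trivializationAt F E q).open_source.mem_nhds ((trivializationAt F E q).mem_source.2 hp))
  exact (contMDiffAt_snd.comp p (he.comp p Z.contMDiff_fst.contMDiffAt)).mdifferentiableAt (by simp)

variable [FiniteDimensional ℝ B] [T2Space Q]

theorem exists_fst_eq_vec_eq {U : Set Q} (hU : IsOpen U) (hprj : ContMDiff IP 𝓘(ℝ, B) ∞ prj)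
    (σ : Cₛ^∞⟮𝓘(ℝ, B); F, E⟯) {X : ∀ p : P, TangentSpace IP p}
    (hX : ContMDiffOn IP IP.tangent ∞ (fun p ↦ (⟨p, X p⟩ : TangentBundle IP P)) (prj ⁻¹' U))
    (hσX : ∀ p ∈ prj ⁻¹' U, A.anchor (prj p) (σ (prj p)) = mfderiv IP 𝓘(ℝ, B) prj p (X p))
    {p : P} (hp : prj p ∈ U) :
    ∃ Z : ProlSection IP A prj, Z.fst p = σ (prj p) ∧ Z.vec p = X p := by
  obtain ⟨χ, -, hχ⟩ :=
    (SmoothBumpFunction.nhds_basis_tsupport (I := 𝓘(ℝ, B)) (prj p)).mem_iff.1 (hU.mem_nhds hp)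
  have hsupp : tsupport (χ ∘ prj) ⊆ prj ⁻¹' U :=
    (tsupport_comp_subset_preimage χ hprj.continuous).trans (preimage_mono hχ)
  have hmem : ∀ p', (χ (prj p') • σ (prj p'), χ (prj p') • X p') ∈ prolFiber IP A prj p' := by
    intro p'
    refine ((A.anchor _).map_smul _ _).trans
      (Eq.trans ?_ ((mfderiv IP 𝓘(ℝ, B) prj p').map_smul _ _).symm)
    by_cases hp' : prj p' ∈ U
    · rw [hσX p' hp']
    · have hzero : χ (prj p') = 0 := image_eq_zero_of_notMem_tsupport fun h ↦ hp' (hχ h)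
      rw [hzero, zero_smul, zero_smul]
  refine ⟨⟨fun p' ↦ ⟨_, hmem p'⟩, (χ.contMDiff.smul_section σ.contMDiff).comp hprj,
    ContMDiffOn.smul_section_of_tsupport (χ.contMDiff.comp hprj).contMDiffOn
      (hU.preimage hprj.continuous) hsupp hX⟩, ?_, ?_⟩
  · exact (congrArg (· • σ (prj p)) χ.eq_one).trans (one_smul ℝ _)
  · exact (congrArg (· • X p) χ.eq_one).trans (one_smul ℝ _)

end ProlSection

section ContactForm

variable [ContMDiffVectorBundle ∞ F E 𝓘(ℝ, B)] {A : LieAlgebroid B F E}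

theorem contactForm_section_eventuallyEq (Z : HamSection A) (p : DualLine F E) :
    (fun p' ↦ contactForm B p' (Z.toFun p')) =ᶠ[𝓝 p] fun p' ↦
      dirDeriv (dualLineModel B F) (Prod.snd : DualLine F E → ℝ) p' (Z.vec p') -
        momentum (dualLineProj p) p' (Z.coeff (dualLineProj p) p') := by
  have hp := FiberBundle.mem_baseSet_trivializationAt' (F := F) (E := E) (dualLineProj p)
  filter_upwards [(contMDiff_dualLineProj (B := B)).continuous.continuousAt.preimage_mem_nhds
    ((trivializationAt F E (dualLineProj p)).open_baseSet.mem_nhds hp)] with p' hp'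
  rw [ProlSection.coeff, momentum_apply_trivializationAt hp']
  rfl

theorem mdifferentiableAt_dirDeriv_snd (Z : HamSection A) (p : DualLine F E) :
    MDifferentiableAt (dualLineModel B F) 𝓘(ℝ, ℝ) (fun p' ↦
      dirDeriv (dualLineModel B F) (Prod.snd : DualLine F E → ℝ) p' (Z.vec p')) p :=
  (contMDiff_dirDeriv contMDiff_snd Z.contMDiff_snd).mdifferentiable (by simp) p

theorem mdifferentiableAt_momentum_coeff (Z : HamSection A) (p : DualLine F E) :
    MDifferentiableAt (dualLineModel B F) 𝓘(ℝ, ℝ)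
      (fun p' ↦ momentum (dualLineProj p) p' (Z.coeff (dualLineProj p) p')) p :=
  have hp := FiberBundle.mem_baseSet_trivializationAt' (F := F) (E := E) (dualLineProj p)
  (mdifferentiableAt_momentum hp).clm_apply (Z.mdifferentiableAt_coeff hp)

theorem mdifferentiable_contactForm_section (Z : HamSection A) :
    MDifferentiable (dualLineModel B F) 𝓘(ℝ, ℝ) (fun p ↦ contactForm B p (Z.toFun p)) := fun p ↦
  ((mdifferentiableAt_dirDeriv_snd Z p).sub
    (mdifferentiableAt_momentum_coeff Z p)).congr_of_eventuallyEq
      (contactForm_section_eventuallyEq Z p)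

theorem dirDeriv_contactForm_section (Z : HamSection A) (p : DualLine F E)
    (v : TangentSpace (dualLineModel B F) p) :
    dirDeriv (dualLineModel B F) (fun p' ↦ contactForm B p' (Z.toFun p')) p v =
      dirDeriv (dualLineModel B F) (fun p' ↦
        dirDeriv (dualLineModel B F) (Prod.snd : DualLine F E → ℝ) p' (Z.vec p')) p v
      - (dirDeriv (dualLineModel B F) (momentum (dualLineProj p)) p v (Z.coeff (dualLineProj p) p)
        + p.1.snd (Z.derivFst p v)) := by
  have hp := FiberBundle.mem_baseSet_trivializationAt' (F := F) (E := E) (dualLineProj p)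
  have hderivFst : p.1.snd (Z.derivFst p v) = momentum (dualLineProj p) p
      (dirDeriv (dualLineModel B F) (Z.coeff (dualLineProj p)) p v) :=
    (momentum_apply hp _).symm
  rw [hderivFst,
    ← dirDeriv_clm_apply (mdifferentiableAt_momentum hp) (Z.mdifferentiableAt_coeff hp),
    dirDeriv_congr (contactForm_section_eventuallyEq Z p)]
  exact DFunLike.congr_fun (((mdifferentiableAt_dirDeriv_snd Z p).hasMFDerivAt.sub
    (mdifferentiableAt_momentum_coeff Z p).hasMFDerivAt).mfderiv) v

variable [FiniteDimensional ℝ B] [T2Space Q]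

theorem exists_hamSection {p : DualLine F E} (z : HamFiber A p) :
    ∃ Z : HamSection A, Z.toFun p = z := by
  have hp := FiberBundle.mem_baseSet_trivializationAt' (F := F) (E := E) (dualLineProj p)
  set q := dualLineProj p
  set σ : Cₛ^∞⟮𝓘(ℝ, B); F, E⟯ := constSection q z.1.1
  set X := dualLineLift (F := F) (E := E) (fun x ↦ A.anchor x (σ x)) q
    (dirDeriv (dualLineModel B F) (momentum q) p z.1.2)
    (dirDeriv (dualLineModel B F) (Prod.snd : DualLine F E → ℝ) p z.1.2)
  have hX : ∀ p' : DualLine F E, dualLineProj p' ∈ (trivializationAt F E q).baseSet →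
      ((mfderiv (dualLineModel B F) 𝓘(ℝ, B) (dualLineProj : DualLine F E → Q) p' (X p'),
        dirDeriv (dualLineModel B F) (momentum q) p' (X p')),
        dirDeriv (dualLineModel B F) (Prod.snd : DualLine F E → ℝ) p' (X p')) =
      ((A.anchor _ (σ (dualLineProj p')), _), _) := fun p' hp' ↦
    (mfderiv_dualLineChart_apply hp' _).symm.trans
      (mfderiv_dualLineChart_dualLineLift (fun x ↦ A.anchor x (σ x)) hp' _ _)
  obtain ⟨Z, hfst, hvec⟩ := ProlSection.exists_fst_eq_vec_eq (A := A) (p := p)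
    (trivializationAt F E q).open_baseSet contMDiff_dualLineProj σ
    (contMDiffOn_dualLineLift (A.contMDiff_anchor_section σ) q _ _)
    (fun p' hp' ↦ (congrArg (·.1.1) (hX p' hp')).symm) hp
  refine ⟨Z, Subtype.ext (Prod.ext (hfst.trans (constSection_self q _)) (hvec.trans ?_))⟩
  refine dualLine_tangent_ext hp ((congrArg (·.1.1) (hX p hp)).trans ?_)
    (congrArg (·.1.2) (hX p hp)) (congrArg (·.2) (hX p hp))
  exact (congrArg (A.anchor q) (constSection_self q _)).trans z.2

variable (A) in
/-- The differential `dη` of the contact form as a tensorial `2`-section of `𝒯^E(E^* × ℝ)`. In the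
frame `(e_α)` of the preferred trivialization at `π(p)`, with momenta `p_α`, it is
`dη(z₁, z₂) = dp_α(z₂) z₁^α - dp_α(z₁) z₂^α + p_γ 𝒞^γ_{αβ} z₁^α z₂^β`. -/
def contactDifferential (p : DualLine F E) (z₁ z₂ : HamFiber A p) : ℝ :=
  dirDeriv (dualLineModel B F) (momentum (dualLineProj p)) p z₂.1.2
      (trivializationAt F E (dualLineProj p) ⟨dualLineProj p, z₁.1.1⟩).2
    - dirDeriv (dualLineModel B F) (momentum (dualLineProj p)) p z₁.1.2
      (trivializationAt F E (dualLineProj p) ⟨dualLineProj p, z₂.1.1⟩).2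
    + p.1.snd (A.bracket (constSection _ z₁.1.1) (constSection _ z₂.1.1) (dualLineProj p))

theorem extDerivOne_contactForm (Z₁ Z₂ : HamSection A) (p : DualLine F E) :
    extDerivOne (contactForm B) Z₁ Z₂ p = contactDifferential A p (Z₁.toFun p) (Z₂.toFun p) := by
  have hbracket := dirDeriv_mlieBracket (X := Z₁.vec) (Y := Z₂.vec)
    (contMDiff_snd.contMDiffAt : ContMDiffAt _ 𝓘(ℝ, ℝ) 2 (Prod.snd : DualLine F E → ℝ) p)
    (Z₁.contMDiff_snd.mdifferentiable (by simp) p) (Z₂.contMDiff_snd.mdifferentiable (by simp) p)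
  rw [extDerivOne, dirDeriv_contactForm_section, dirDeriv_contactForm_section, prolBracket,
    contactForm_apply, map_sub, map_add]
  simp only [hbracket, contactDifferential, ProlSection.coeff, ProlSection.fst, ProlSection.vec]
  ring

theorem hamFiber_ext {p : DualLine F E} {z w : HamFiber A p} (hfst : z.1.1 = w.1.1)
    (hη : contactForm B p z = contactForm B p w)
    (hdη : ∀ a, ∃ z' : HamFiber A p, z'.1.1 = a ∧
      contactDifferential A p z z' = contactDifferential A p w z') : z = w := by
  have hp := FiberBundle.mem_baseSet_trivializationAt' (F := F) (E := E) (dualLineProj p)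
  refine Subtype.ext (Prod.ext hfst (dualLine_tangent_ext hp ?_ ?_ ?_))
  · rw [← z.2, ← w.2, hfst]
  · ext x
    obtain ⟨z', hz', h⟩ := hdη ((trivializationAt F E (dualLineProj p)).symm _ x)
    rw [contactDifferential, contactDifferential, hz', hfst, Trivialization.apply_mk_symm _ hp] at h
    linarith
  · rw [contactForm_apply, contactForm_apply, hfst] at hη
    exact sub_left_injective hη

variable {R ξ : HamSection A} {H : DualLine F E → ℝ}

theorem IsHamiltonianSection.mdifferentiable (hξ : IsHamiltonianSection R H ξ) :
    MDifferentiable (dualLineModel B F) 𝓘(ℝ, ℝ) H := by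
  have hH : H = -fun p ↦ contactForm B p (ξ.toFun p) :=
    funext fun p ↦ (neg_eq_iff_eq_neg.2 (hξ.contactForm_eq p)).symm
  rw [hH]
  exact (mdifferentiable_contactForm_section ξ).neg

theorem IsHamiltonianSection.contactDifferential_eq (hξ : IsHamiltonianSection R H ξ)
    {p : DualLine F E} (z : HamFiber A p) :
    contactDifferential A p (ξ.toFun p) z = dirDeriv (dualLineModel B F) H p z.1.2 -
      dirDeriv (dualLineModel B F) H p (R.vec p) * contactForm B p z := by
  obtain ⟨Z, rfl⟩ := exists_hamSection z
  rw [← extDerivOne_contactForm]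
  exact hξ.extDeriv_eq Z p

end ContactForm

section Gamma

variable {A : LieAlgebroid B F E}
  {γ₀ : Cₛ^∞⟮𝓘(ℝ, B); F →L[ℝ] ℝ, fun q ↦ E q →L[ℝ] ℝ⟯}
  {γₛ : C^∞⟮𝓘(ℝ, B), Q; 𝓘(ℝ, ℝ), ℝ⟯}

variable (A γ₀ γₛ) in
/-- The section `γ = (γ₀, γₛ)` of `E^* × ℝ` is the `1`-jet of the function `γₛ`, i.e.
`γ₀ = d^E γₛ`. -/
def IsOneJet : Prop :=
  ∀ q (a : E q), γ₀ q a = dirDeriv 𝓘(ℝ, B) γₛ q (A.anchor q a)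

theorem IsOneJet.isLocallyOneJet (h : IsOneJet A γ₀ γₛ) : IsLocallyOneJet A γ₀ γₛ := fun q ↦
  ⟨univ, γₛ, isOpen_univ, mem_univ q, γₛ.contMDiff.contMDiffOn, fun q _ ↦ ⟨rfl, h q⟩⟩

variable [∀ q, IsTopologicalAddGroup (E q)] [∀ q, ContinuousSMul ℝ (E q)]
  [ContMDiffVectorBundle ∞ F E 𝓘(ℝ, B)]

theorem dirDeriv_gammaMap {W : Type*} [NormedAddCommGroup W] [NormedSpace ℝ W]
    {g : DualLine F E → W} {q : Q}
    (hg : MDifferentiableAt (dualLineModel B F) 𝓘(ℝ, W) g (gammaMap γ₀ γₛ q))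
    (v : TangentSpace 𝓘(ℝ, B) q) :
    dirDeriv (dualLineModel B F) g (gammaMap γ₀ γₛ q)
      (mfderiv 𝓘(ℝ, B) (dualLineModel B F) (gammaMap γ₀ γₛ) q v) =
    dirDeriv 𝓘(ℝ, B) (g ∘ gammaMap γ₀ γₛ) q v :=
  (dirDeriv_comp_mfderiv hg ((contMDiff_gammaMap γ₀ γₛ).mdifferentiable (by simp) q) v).symm

theorem contactForm_gammaLift (q : Q) (a : E q) :
    contactForm B (gammaMap γ₀ γₛ q) (gammaLift A γ₀ γₛ q a) =
      dirDeriv 𝓘(ℝ, B) γₛ q (A.anchor q a) - γ₀ q a :=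
  congrArg (· - γ₀ q a) (dirDeriv_gammaMap mdifferentiableAt_snd (A.anchor q a))

theorem isOneJet_iff_contactForm_gammaSub : IsOneJet A γ₀ γₛ ↔
    ∀ q, ∀ z ∈ gammaSub A γ₀ γₛ q, contactForm B (gammaMap γ₀ γₛ q) z = 0 := by
  refine forall_congr' fun q ↦ Iff.trans (forall_congr' fun a ↦ ?_) forall_mem_range.symm
  rw [contactForm_gammaLift, sub_eq_zero, eq_comm]

variable [FiniteDimensional ℝ B] [T2Space Q]

theorem dirDeriv_momentum_gammaMap (h : IsOneJet A γ₀ γₛ) (q : Q) (a : E q)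
    (v : TangentSpace 𝓘(ℝ, B) q) :
    dirDeriv (dualLineModel B F) (momentum q) (gammaMap γ₀ γₛ q)
        (mfderiv 𝓘(ℝ, B) (dualLineModel B F) (gammaMap γ₀ γₛ) q v)
        (trivializationAt F E q ⟨q, a⟩).2 =
      dirDeriv 𝓘(ℝ, B) (A.lieDeriv (constSection q a) γₛ) q v := by
  have hq := FiberBundle.mem_baseSet_trivializationAt' (F := F) (E := E) q
  have hmom := mdifferentiableAt_momentum (p := gammaMap γ₀ γₛ q) (B := B) hq
  set x := (trivializationAt F E q ⟨q, a⟩).2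
  have hlie : (fun q' ↦ momentum q (gammaMap γ₀ γₛ q') x) =ᶠ[𝓝 q]
      A.lieDeriv (constSection q a) γₛ := by
    filter_upwards [eventually_constSection_apply (B := B) (F := F) q a,
      (trivializationAt F E q).open_baseSet.mem_nhds hq] with q' hconst hq'
    exact (momentum_apply (p := gammaMap γ₀ γₛ q') hq' x).trans
      ((congrArg (γ₀ q') hconst.symm).trans (h q' _))
  have hcoord := dirDeriv_clm_apply (hmom.comp q
    ((contMDiff_gammaMap γ₀ γₛ).mdifferentiable (by simp) q)) (mdifferentiableAt_const (c := x)) v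
  rw [dirDeriv_const, map_zero, add_zero] at hcoord
  rw [dirDeriv_gammaMap hmom, ← dirDeriv_congr hlie]
  exact hcoord.symm

theorem contactDifferential_gammaLift (h : IsOneJet A γ₀ γₛ) (q : Q) (a a' : E q) :
    contactDifferential A (gammaMap γ₀ γₛ q) (gammaLift A γ₀ γₛ q a) (gammaLift A γ₀ γₛ q a') =
      0 := by
  set σ : Cₛ^∞⟮𝓘(ℝ, B); F, E⟯ := constSection q a
  set σ' : Cₛ^∞⟮𝓘(ℝ, B); F, E⟯ := constSection q a'
  have hbracket : γ₀ q (A.bracket σ σ' q) =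
      A.lieDeriv σ (A.lieDeriv σ' γₛ) q - A.lieDeriv σ' (A.lieDeriv σ γₛ) q :=
    (h q _).trans (DFunLike.congr_fun (A.lieDeriv_bracket σ σ' γₛ) q)
  rw [A.lieDeriv_apply, A.lieDeriv_apply, constSection_self, constSection_self,
    ← dirDeriv_momentum_gammaMap h, ← dirDeriv_momentum_gammaMap h] at hbracket
  exact (congrArg _ hbracket).trans ((sub_add_sub_cancel _ _ _).trans (sub_self _))

variable {R ξ : HamSection A} {H : DualLine F E → ℝ}

theorem IsHamiltonianSection.hamilton_jacobi_of_gammaRelated (hξ : IsHamiltonianSection R H ξ)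
    (h : IsOneJet A γ₀ γₛ) {σ : Cₛ^∞⟮𝓘(ℝ, B); F, E⟯} (hrel : GammaRelated γ₀ γₛ ξ σ) (q : Q) :
    H (gammaMap γ₀ γₛ q) = 0 := by
  rw [← neg_eq_zero, ← hξ.contactForm_eq, hrel q, contactForm_gammaLift, h, sub_self]

theorem IsHamiltonianSection.gammaRelated_of_hamilton_jacobi (hξ : IsHamiltonianSection R H ξ)
    (h : IsOneJet A γ₀ γₛ) (hHJ : ∀ q, H (gammaMap γ₀ γₛ q) = 0) :
    GammaRelated γ₀ γₛ ξ (inducedSection γ₀ γₛ ξ) := by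
  intro q
  have hη (a : E q) : contactForm B (gammaMap γ₀ γₛ q) (gammaLift A γ₀ γₛ q a) = 0 := by
    rw [contactForm_gammaLift, h, sub_self]
  have hdH (v : TangentSpace 𝓘(ℝ, B) q) : dirDeriv (dualLineModel B F) H (gammaMap γ₀ γₛ q)
      (mfderiv 𝓘(ℝ, B) (dualLineModel B F) (gammaMap γ₀ γₛ) q v) = 0 := by
    have hzero : H ∘ gammaMap γ₀ γₛ = fun _ ↦ 0 := funext hHJ
    rw [dirDeriv_gammaMap (hξ.mdifferentiable _), hzero, dirDeriv_const]
  refine hamFiber_ext rfl ?_ fun (a : E q) ↦ ⟨gammaLift A γ₀ γₛ q a, rfl, ?_⟩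
  · rw [hξ.contactForm_eq, hHJ, neg_zero, hη]
  · rw [hξ.contactDifferential_eq, hη, mul_zero, sub_zero, contactDifferential_gammaLift h]
    exact hdH _

end Gamma

end Algebroid

end ContactAlgebroid

end

open ContactAlgebroid in
theorem mainTheorem7_general
    {B : Type*} [NormedAddCommGroup B] [NormedSpace ℝ B] [FiniteDimensional ℝ B]
    {Q : Type*} [TopologicalSpace Q] [T2Space Q] [ChartedSpace B Q] [IsManifold 𝓘(ℝ, B) ∞ Q]
    {F : Type*} [NormedAddCommGroup F] [NormedSpace ℝ F]
    {E : Q → Type*} [∀ q, AddCommGroup (E q)] [∀ q, Module ℝ (E q)] [∀ q, TopologicalSpace (E q)]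
    [∀ q, IsTopologicalAddGroup (E q)] [∀ q, ContinuousSMul ℝ (E q)]
    [TopologicalSpace (TotalSpace F E)] [FiberBundle F E] [VectorBundle ℝ F E]
    [ContMDiffVectorBundle ∞ F E 𝓘(ℝ, B)]
    (A : LieAlgebroid B F E)
    (H : DualLine F E → ℝ)
    (R : HamSection A) (_hR : IsReebSection R)
    (ξ : HamSection A) (hξ : IsHamiltonianSection R H ξ)
    (γ₀ : Cₛ^∞⟮𝓘(ℝ, B); F →L[ℝ] ℝ, fun q ↦ E q →L[ℝ] ℝ⟯)
    (γₛ : C^∞⟮𝓘(ℝ, B), Q; 𝓘(ℝ, ℝ), ℝ⟯)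
    (hγ : ∀ q, ∀ z ∈ gammaSub A γ₀ γₛ q, contactForm B (gammaMap γ₀ γₛ q) z = 0) :
    IsLocallyOneJet A γ₀ γₛ ∧
      (GammaRelated γ₀ γₛ ξ (inducedSection γ₀ γₛ ξ) ↔ ∀ q : Q, H (gammaMap γ₀ γₛ q) = 0) := by
  have hjet : IsOneJet A γ₀ γₛ := isOneJet_iff_contactForm_gammaSub.2 hγ
  exact ⟨hjet.isLocallyOneJet, fun hrel ↦ hξ.hamilton_jacobi_of_gammaRelated hjet hrel,
    fun hHJ ↦ hξ.gammaRelated_of_hamilton_jacobi hjet hHJ⟩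

open ContactAlgebroid in
theorem mainTheorem7
    {B : Type*} [NormedAddCommGroup B] [NormedSpace ℝ B] [FiniteDimensional ℝ B]
    {Q : Type*} [TopologicalSpace Q] [T2Space Q] [ChartedSpace B Q] [IsManifold 𝓘(ℝ, B) ∞ Q]
    {F : Type*} [NormedAddCommGroup F] [NormedSpace ℝ F] [FiniteDimensional ℝ F]
    {E : Q → Type*} [∀ q, AddCommGroup (E q)] [∀ q, Module ℝ (E q)] [∀ q, TopologicalSpace (E q)]
    [∀ q, IsTopologicalAddGroup (E q)] [∀ q, ContinuousSMul ℝ (E q)]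
    [TopologicalSpace (TotalSpace F E)] [FiberBundle F E] [VectorBundle ℝ F E]
    [ContMDiffVectorBundle ∞ F E 𝓘(ℝ, B)]
    (A : LieAlgebroid B F E)
    (H : DualLine F E → ℝ) (hH : ContMDiff (dualLineModel B F) 𝓘(ℝ, ℝ) ∞ H)
    (R : HamSection A) (hR : IsReebSection R)
    (ξ : HamSection A) (hξ : IsHamiltonianSection R H ξ)
    (γ₀ : Cₛ^∞⟮𝓘(ℝ, B); F →L[ℝ] ℝ, fun q ↦ E q →L[ℝ] ℝ⟯)
    (γₛ : C^∞⟮𝓘(ℝ, B), Q; 𝓘(ℝ, ℝ), ℝ⟯)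
    (hγ : IsLegendrian A (contactForm B) (gammaMap γ₀ γₛ) (gammaSub A γ₀ γₛ)) :
    IsLocallyOneJet A γ₀ γₛ ∧
      (GammaRelated γ₀ γₛ ξ (inducedSection γ₀ γₛ ξ) ↔ ∀ q : Q, H (gammaMap γ₀ γₛ q) = 0) :=
  mainTheorem7_general A H R hR ξ hξ γ₀ γₛ fun q ↦ (hγ q).2
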